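/- Let $B: L_2(\mathbb{R})\to L_2(\mathbb{R})$ be an injective bounded linear operator on the complex Hilbert space $L_2(\mathbb{R})$, and let $c_0>0$ be such that the spectrum of $BB^*$ is contained in $[0,c_0]$ (that is, $\|B\|^2\le c_0$) and $BB^*-\lambda I$ is injective for $\lambda=0$ and for $\lambda=c_0$. Let $\psi$ be a function that is non-negative and monotonically increasing (not necessarily strictly) on $(1/c_0,\infty)$. For $g\in L_2(\mathbb{R})$ put $$\|g\|_\psi^2=\bigl(g,\psi((BB^*)^{-1})g\bigr)=\int \psi(1/t)\,d\mu_g(t)\in[0,\infty],$$ where $\mu_g$ is the spectral measure of $BB^*$ at $g$ (the Borel measure with $\int \varphi\,d\mu_g=(g,\varphi(BB^*)g)$ for all continuous compactly supported $\varphi$; it is concentrated on $(0,c_0)$), and let $H_\psi$ be the space of all $g\in L_2(\mathbb{R})$ with $\|g\|_\psi<\infty$. Let $J\subseteq\mathbb{R}$ be an interval unbounded above with $\psi(\lambda)\in J$ for all $\lambda>1/c_0$ (for example $J=(1/c_0,\infty)$ if $\psi>1/c_0$ there), and let $\Psi$ be a function that is non-negative, monotonically increasing and concave on $J$ and satisfies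 $\Psi(\psi(\lambda))\ge\lambda$ for all $\lambda>1/c_0$. Let $f,f_\alpha\in L_2(\mathbb{R})$ be such that $g=Bf\in H_\psi$ and $Bf_\alpha\in H_\psi$, with $$\|Bf_\alpha\|_\psi\le C\quad\text{and}\quad \|Bf_\alpha-g\|=\epsilon .$$ Then $$\|f-f_\alpha\|\le \epsilon\,\sqrt{\Psi\bigl((C+\|g\|_\psi)^2/\epsilon^2\bigr)},$$ where the right-hand side is read as $0$ if $\epsilon=0$. -/

import Mathlib

open MeasureTheory
open scoped ENNReal CompactlySupported InnerProductSpace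

noncomputable section

/-- The complex Hilbert space `L₂(ℝ)`. -/
abbrev L2R : Type := Lp ℂ 2 (volume : Measure ℝ)

section Spectral

variable {H : Type*} [NormedAddCommGroup H] [InnerProductSpace ℂ H] [CompleteSpace H]

/-- The positive functional `f ↦ (x, f(T) x)` on the compactly supported continuous functions,
where `f(T)` is the continuous functional calculus of the self-adjoint operator `T`. -/
def spectralFunctional (T : H →L[ℂ] H) (x : H) : C_c(ℝ, ℝ) →ₚ[ℝ] ℝ :=
  PositiveLinearMap.mk₀
    { toFun := fun f => (⟪x, cfc (fun t => f t) T x⟫_ℂ).re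
      map_add' := fun f g => by
        have h := cfc_add (R := ℝ) (a := T) (fun t => f t) (fun t => g t)
          f.continuous.continuousOn g.continuous.continuousOn
        simp only [CompactlySupportedContinuousMap.coe_add, Pi.add_apply, h,
          _root_.add_apply, inner_add_right, Complex.add_re]
      map_smul' := fun c f => by
        have h := cfc_smul (R := ℝ) (a := T) c (fun t => f t) f.continuous.continuousOn
        simp only [smul_eq_mul] at h
        simp only [CompactlySupportedContinuousMap.coe_smul, Pi.smul_apply, smul_eq_mul,
          RingHom.id_apply, h]
        rw [_root_.smul_apply, inner_smul_right_eq_smul, Complex.smul_re, smul_eq_mul] }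
    (fun f hf => by
      have h : (0 : H →L[ℂ] H) ≤ cfc (fun t => f t) T := cfc_nonneg fun t _ => hf t
      have h2 := (ContinuousLinearMap.nonneg_iff_isPositive _).1 h
      exact h2.re_inner_nonneg_right x)

/-- The spectral measure `μ_x = (x, E(·) x)` of the self-adjoint operator `T` at the vector `x`:
the Borel measure on `ℝ` with `∫ f dμ_x = (x, f(T) x)` for compactly supported continuous `f`. -/
def spectralMeasure (T : H →L[ℂ] H) (x : H) : Measure ℝ :=
  RealRMK.rieszMeasure (spectralFunctional T x)

/-- The quadratic form `(g, ψ((BB*)⁻¹) g) = ∫ ψ(1/t) dμ_g(t)` in `[0, ∞]`, where `μ_g` is the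
spectral measure of `BB*` at `g`. If `BB*` is injective, the point `t = 0` is a null set. -/
def scaleForm (B : H →L[ℂ] H) (ψ : ℝ → ℝ) (g : H) : ℝ≥0∞ :=
  ∫⁻ t, ENNReal.ofReal (ψ t⁻¹) ∂(spectralMeasure (B ∘L B.adjoint) g)

/-- The space `H_ψ`: the vectors at which the quadratic form of `ψ((BB*)⁻¹)` is finite. -/
def scaleSpace (B : H →L[ℂ] H) (ψ : ℝ → ℝ) : Set H :=
  {g | scaleForm B ψ g < ∞}

/-- The norm `‖g‖_ψ = (g, ψ((BB*)⁻¹) g)^{1/2}` of an element `g` of `H_ψ`. -/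
def scaleNorm (B : H →L[ℂ] H) (ψ : ℝ → ℝ) (g : H) : ℝ :=
  Real.sqrt (scaleForm B ψ g).toReal

end Spectral

end

/-!
Put `T = BB*` and `h = B f_α - g = B (f_α - f)`, and let `μ` be the spectral measure of `T` at `h`.
The bound comes from three facts about `μ`, which is a measure of total mass `‖h‖² = ε²` carried by
`(0, c₀)` (the spectrum lies in `[0, c₀]`, and since its end points are not eigenvalues they have no
mass, `spectralMeasure_singleton_eq_zero`).

* `‖f_α - f‖² ≤ ∫ t⁻¹ dμ`, from Cauchy–Schwarz for the resolvent of `T` and the density of the range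
  of `B*` (`norm_sq_le_lintegral_inv_spectralMeasure`).
* `∫ ψ(t⁻¹) dμ ≤ (C + ‖g‖_ψ)²`, the triangle inequality for `‖·‖_ψ`
  (`sqrt_lintegral_spectralMeasure_sub_le`). As no Borel functional calculus is at hand, it is
  derived from a weighted parallelogram identity between spectral measures at different vectors,
  itself a consequence of the uniqueness part of the Riesz–Markov–Kakutani theorem.
* `t⁻¹ ≤ Ψ(ψ(t⁻¹))` almost everywhere, so that Jensen's inequality for the concave function `Ψ` and
  the probability measure `μ / ε²` bounds `ε⁻² ∫ t⁻¹ dμ` by `Ψ` of the mean of `ψ(t⁻¹)`, which is at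
  most `Ψ((C + ‖g‖_ψ)² / ε²)` by monotonicity (`lintegral_le_of_le_concave`).
-/

variable {H : Type*} [NormedAddCommGroup H] [InnerProductSpace ℂ H] [CompleteSpace H]

/-! ### The spectral measure and the functional calculus -/

instance regular_spectralMeasure (T : H →L[ℂ] H) (x : H) : (spectralMeasure T x).Regular :=
  RealRMK.regular_rieszMeasure _

theorem integral_spectralMeasure (T : H →L[ℂ] H) (x : H) {φ : ℝ → ℝ} (hφ : Continuous φ)
    (hφc : HasCompactSupport φ) :
    ∫ t, φ t ∂(spectralMeasure T x) = (⟪x, cfc φ T x⟫_ℂ).re :=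
  RealRMK.integral_rieszMeasure (spectralFunctional T x) ⟨⟨φ, hφ⟩, hφc⟩

theorem lintegral_spectralMeasure (T : H →L[ℂ] H) (x : H) {φ : ℝ → ℝ} (hφ : Continuous φ)
    (hφc : HasCompactSupport φ) (hφ0 : ∀ t, 0 ≤ φ t) :
    ∫⁻ t, ENNReal.ofReal (φ t) ∂(spectralMeasure T x) =
      ENNReal.ofReal (⟪x, cfc φ T x⟫_ℂ).re := by
  rw [← integral_spectralMeasure T x hφ hφc, ofReal_integral_eq_lintegral_ofReal
    (hφ.integrable_of_hasCompactSupport hφc) (ae_of_all _ hφ0)]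

theorem ae_mem_spectrum_spectralMeasure (T : H →L[ℂ] H) (x : H) :
    ∀ᵐ t ∂(spectralMeasure T x), t ∈ spectrum ℝ T := by
  refine measure_null_of_locally_null _ fun c hc => ?_
  obtain ⟨φ, hφc, hφ0, hφs, hφI⟩ := exists_continuous_one_zero_of_isCompact
    (isCompact_singleton (x := c)) (spectrum.isClosed (𝕜 := ℝ) T)
    (Set.disjoint_singleton_left.2 hc)
  refine ⟨{t | ENNReal.ofReal (φ t) ≠ 0}, mem_nhdsWithin_of_mem_nhds ?_, ?_⟩
  · refine (isOpen_ne_fun (ENNReal.continuous_ofReal.comp φ.continuous) continuous_const).mem_nhds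
      ?_
    simp [hφc rfl]
  · have h0 : cfc φ T = 0 := by
      rw [cfc_congr hφ0]
      exact cfc_zero ℝ T
    have h := lintegral_spectralMeasure T x φ.continuous hφs fun t => (hφI t).1
    rw [h0] at h
    simp only [_root_.zero_apply, inner_zero_right, Complex.zero_re, ENNReal.ofReal_zero] at h
    rw [lintegral_eq_zero_iff (by fun_prop)] at h
    exact h

theorem norm_cfc_apply_sq {T : H →L[ℂ] H} (x : H) {p : ℝ → ℝ}
    (hp : Continuous p) : ‖cfc p T x‖ ^ 2 = (⟪x, cfc (fun t => p t ^ 2) T x⟫_ℂ).re := by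
  have hs : IsSelfAdjoint (cfc p T) := cfc_predicate p T
  have h : cfc (fun t => p t ^ 2) T = cfc p T * cfc p T := by
    rw [← cfc_mul p p T hp.continuousOn hp.continuousOn]
    simp only [sq]
  rw [h, show (cfc p T * cfc p T) x = cfc p T (cfc p T x) from rfl,
    ← ContinuousLinearMap.adjoint_inner_left, hs.adjoint_eq, inner_self_eq_norm_sq_to_K]
  norm_cast

/-- The isometry `∫ p² dμ_x = ‖p(T) x‖²`, for `p` continuous but not necessarily compactly
supported: outside the spectrum, which is compact and carries `μ_x`, `p` can be cut off. -/
theorem lintegral_sq_spectralMeasure (T : H →L[ℂ] H) (x : H) {p : ℝ → ℝ}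
    (hp : Continuous p) :
    ∫⁻ t, ENNReal.ofReal (p t ^ 2) ∂(spectralMeasure T x) =
      ENNReal.ofReal (‖cfc p T x‖ ^ 2) := by
  obtain ⟨χ, hχ1, -, hχs, hχI⟩ := exists_continuous_one_zero_of_isCompact
    (spectrum.isCompact (𝕜 := ℝ) T) isClosed_empty (Set.disjoint_empty _)
  have hc : cfc (fun t => p t ^ 2) T = cfc (fun t => χ t * p t ^ 2) T :=
    cfc_congr fun t ht => by simp [hχ1 ht]
  have hs : HasCompactSupport fun t => χ t * p t ^ 2 := hχs.mul_right
  have hcont : Continuous fun t => χ t * p t ^ 2 := by fun_prop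
  rw [norm_cfc_apply_sq x hp, hc, ← lintegral_spectralMeasure T x hcont hs
    fun t => mul_nonneg (hχI t).1 (sq_nonneg (p t))]
  refine lintegral_congr_ae ?_
  filter_upwards [ae_mem_spectrum_spectralMeasure T x] with t ht
  simp [hχ1 ht]

theorem spectralMeasure_univ {T : H →L[ℂ] H} (hT : IsSelfAdjoint T) (x : H) :
    spectralMeasure T x Set.univ = ENNReal.ofReal (‖x‖ ^ 2) := by
  have h := lintegral_sq_spectralMeasure T x (p := fun _ => 1) continuous_const
  rw [cfc_const_one ℝ T] at h
  simpa using h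

theorem isFiniteMeasure_spectralMeasure {T : H →L[ℂ] H} (hT : IsSelfAdjoint T) (x : H) :
    IsFiniteMeasure (spectralMeasure T x) :=
  ⟨by rw [spectralMeasure_univ hT]; exact ENNReal.ofReal_lt_top⟩

/-! ### Dependence of the spectral measure on the vector -/

/-- A weighted parallelogram identity: both sides expand to the same quadratic form in `(x, y)`,
the mixed terms of the left side cancelling. -/
theorem spectralMeasure_sub_add {T : H →L[ℂ] H} (hT : IsSelfAdjoint T) (x y : H)
    {r : ℝ} (hr : 0 < r) :
    spectralMeasure T (x - y) + spectralMeasure T ((√r : ℂ) • x + ((√r)⁻¹ : ℂ) • y) =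
      ENNReal.ofReal (1 + r) • spectralMeasure T x +
        ENNReal.ofReal (1 + r⁻¹) • spectralMeasure T y := by
  have hfin := fun z => isFiniteMeasure_spectralMeasure hT z
  have := (spectralMeasure T x).smul_finite (c := ENNReal.ofReal (1 + r)) ENNReal.ofReal_ne_top
  have := (spectralMeasure T y).smul_finite (c := ENNReal.ofReal (1 + r⁻¹)) ENNReal.ofReal_ne_top
  refine Measure.ext_of_integral_eq_on_compactlySupported fun f => ?_
  have hf : ∀ z, ∫ t, f t ∂(spectralMeasure T z) = (⟪z, cfc f T z⟫_ℂ).re := fun z =>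
    integral_spectralMeasure T z f.continuous f.hasCompactSupport
  rw [integral_add_measure f.integrable f.integrable,
    integral_add_measure f.integrable f.integrable, integral_smul_measure, integral_smul_measure,
    hf, hf, hf, hf, ENNReal.toReal_ofReal (by positivity), ENNReal.toReal_ofReal (by positivity)]
  have hs : √r ≠ 0 := (Real.sqrt_pos.2 hr).ne'
  have h1 : √r * √r = r := Real.mul_self_sqrt hr.le
  have h2 : (√r)⁻¹ * (√r)⁻¹ = r⁻¹ := by rw [← mul_inv, h1]
  simp only [← Complex.ofReal_inv, map_add, map_sub, map_smul, inner_add_left, inner_add_right,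
    inner_sub_left, inner_sub_right, inner_smul_left, inner_smul_right, Complex.conj_ofReal,
    Complex.add_re, Complex.sub_re, Complex.re_ofReal_mul, smul_eq_mul]
  linear_combination (⟪x, cfc f T x⟫_ℂ).re * h1 + (⟪y, cfc f T y⟫_ℂ).re * h2 +
    ((⟪x, cfc f T y⟫_ℂ).re + (⟪y, cfc f T x⟫_ℂ).re) * mul_inv_cancel₀ hs

theorem spectralMeasure_sub_le {T : H →L[ℂ] H} (hT : IsSelfAdjoint T) (x y : H)
    {r : ℝ} (hr : 0 < r) :
    spectralMeasure T (x - y) ≤ ENNReal.ofReal (1 + r) • spectralMeasure T x +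
      ENNReal.ofReal (1 + r⁻¹) • spectralMeasure T y := by
  rw [← spectralMeasure_sub_add hT x y hr]
  exact Measure.le_add_right le_rfl

/-- The bound is the infimum over `r` of the hypothesis, attained at `r = b / a`; perturbing `a` and
`b` avoids a division by zero. -/
theorem le_add_sq_of_forall_le {X a b : ℝ} (ha : 0 ≤ a) (hb : 0 ≤ b)
    (h : ∀ r : ℝ, 0 < r → X ≤ (1 + r) * a ^ 2 + (1 + r⁻¹) * b ^ 2) : X ≤ (a + b) ^ 2 := by
  refine Real.sqrt_le_left (by positivity) |>.1 (le_of_forall_pos_le_add fun η hη => ?_)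
  refine Real.sqrt_le_iff.2 ⟨by positivity, ?_⟩
  have ha' : 0 < a + η / 2 := by positivity
  have hb' : 0 < b + η / 2 := by positivity
  refine (h ((b + η / 2) / (a + η / 2)) (by positivity)).trans ?_
  calc _ ≤ (1 + (b + η / 2) / (a + η / 2)) * (a + η / 2) ^ 2 +
        (1 + ((b + η / 2) / (a + η / 2))⁻¹) * (b + η / 2) ^ 2 := by
        gcongr <;> linarith
    _ = (a + b + η) ^ 2 := by field_simp; ring

/-- The square root of `x ↦ ∫ φ dμ_x` satisfies the triangle inequality; `φ` need not be
measurable. -/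
theorem sqrt_lintegral_spectralMeasure_sub_le {T : H →L[ℂ] H} (hT : IsSelfAdjoint T)
    (φ : ℝ → ℝ≥0∞) {x y : H} (hx : ∫⁻ t, φ t ∂(spectralMeasure T x) ≠ ∞)
    (hy : ∫⁻ t, φ t ∂(spectralMeasure T y) ≠ ∞) :
    ∫⁻ t, φ t ∂(spectralMeasure T (x - y)) ≤
      ENNReal.ofReal ((√(∫⁻ t, φ t ∂(spectralMeasure T x)).toReal +
        √(∫⁻ t, φ t ∂(spectralMeasure T y)).toReal) ^ 2) := by
  have key : ∀ r : ℝ, 0 < r → ∫⁻ t, φ t ∂(spectralMeasure T (x - y)) ≤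
      ENNReal.ofReal (1 + r) * ∫⁻ t, φ t ∂(spectralMeasure T x) +
        ENNReal.ofReal (1 + r⁻¹) * ∫⁻ t, φ t ∂(spectralMeasure T y) := fun r hr => by
    refine (lintegral_mono' (spectralMeasure_sub_le hT x y hr) le_rfl).trans ?_
    rw [lintegral_add_measure, lintegral_smul_measure, lintegral_smul_measure]
    rfl
  lift ∫⁻ t, φ t ∂(spectralMeasure T x) to NNReal using hx with a
  lift ∫⁻ t, φ t ∂(spectralMeasure T y) to NNReal using hy with b
  simp only [ENNReal.coe_toReal]
  have hle : ∀ r : ℝ, 0 < r → ∫⁻ t, φ t ∂(spectralMeasure T (x - y)) ≤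
      ENNReal.ofReal ((1 + r) * √a ^ 2 + (1 + r⁻¹) * √b ^ 2) := fun r hr => by
    rw [Real.sq_sqrt a.coe_nonneg, Real.sq_sqrt b.coe_nonneg,
      ENNReal.ofReal_add (by positivity) (by positivity),
      ENNReal.ofReal_mul (by positivity), ENNReal.ofReal_mul (by positivity),
      ENNReal.ofReal_coe_nnreal, ENNReal.ofReal_coe_nnreal]
    exact key r hr
  have hfin := ne_top_of_le_ne_top ENNReal.ofReal_ne_top (hle 1 one_pos)
  rw [ENNReal.le_ofReal_iff_toReal_le hfin (by positivity)]
  refine le_add_sq_of_forall_le (Real.sqrt_nonneg _) (Real.sqrt_nonneg _) fun r hr => ?_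
  exact (ENNReal.le_ofReal_iff_toReal_le hfin (by positivity)).1 (hle r hr)

/-! ### Atoms -/

/-- On a vector `(T - c) z` the mass of `{c}` is at most `∫ p² dμ = ‖p(T) (T - c) z‖² ≤ δ² ‖z‖²`,
where `p` is a tent of half-width `δ` at `c`. -/
theorem spectralMeasure_singleton_of_range {T : H →L[ℂ] H} (hT : IsSelfAdjoint T) (c : ℝ) (z : H) :
    spectralMeasure T (T z - (c : ℂ) • z) {c} = 0 := by
  have key : ∀ δ : ℝ, 0 < δ →
      spectralMeasure T (T z - (c : ℂ) • z) {c} ≤ ENNReal.ofReal ((δ * ‖z‖) ^ 2) := by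
    intro δ hδ
    set p : ℝ → ℝ := fun t => max 0 (1 - |t - c| / δ) with hp
    have hpc : Continuous p := by fun_prop
    have hpn : ∀ t, ‖p t * (t - c)‖ ≤ δ := by
      intro t
      rw [norm_mul, Real.norm_eq_abs, Real.norm_eq_abs, abs_of_nonneg (le_max_left _ _)]
      rcases le_total (|t - c|) δ with h | h
      · have h1 : p t ≤ 1 := max_le zero_le_one (by
          linarith [div_nonneg (abs_nonneg (t - c)) hδ.le])
        have h0 : 0 ≤ p t := le_max_left _ _
        exact (mul_le_mul h1 h (abs_nonneg _) zero_le_one).trans_eq (one_mul _)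
      · have h0 : p t = 0 := max_eq_left (by rw [sub_nonpos, one_le_div hδ]; exact h)
        change p t * |t - c| ≤ δ
        rw [h0, zero_mul]
        exact hδ.le
    have happ : cfc p T (T z - (c : ℂ) • z) = cfc (fun t => p t * (t - c)) T z := by
      rw [cfc_mul p (fun t => t - c) T hpc.continuousOn (by fun_prop),
        cfc_sub (fun t => t) (fun _ => c) T, cfc_id' ℝ T, cfc_const c T]
      simp [Algebra.algebraMap_eq_smul_one]
    calc spectralMeasure T (T z - (c : ℂ) • z) {c}
        = ∫⁻ t in {c}, ENNReal.ofReal (p t ^ 2) ∂(spectralMeasure T (T z - (c : ℂ) • z)) := by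
          simp [hp]
      _ ≤ ∫⁻ t, ENNReal.ofReal (p t ^ 2) ∂(spectralMeasure T (T z - (c : ℂ) • z)) :=
          setLIntegral_le_lintegral _ _
      _ ≤ ENNReal.ofReal ((δ * ‖z‖) ^ 2) := by
          rw [lintegral_sq_spectralMeasure T _ hpc, happ]
          gcongr
          exact (ContinuousLinearMap.le_opNorm _ _).trans
            (by gcongr; exact norm_cfc_le hδ.le fun t _ => hpn t)
  refine le_antisymm (ge_of_tendsto (x := nhdsWithin 0 (Set.Ioi 0)) ?_
    (eventually_nhdsWithin_of_forall key)) bot_le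
  refine tendsto_nhdsWithin_of_tendsto_nhds ?_
  have : Continuous fun δ : ℝ => ENNReal.ofReal ((δ * ‖z‖) ^ 2) :=
    ENNReal.continuous_ofReal.comp (by fun_prop)
  simpa using this.tendsto 0

theorem ContinuousLinearMap.denseRange_of_injective_adjoint {A : H →L[ℂ] H}
    (hA : Function.Injective A.adjoint) : DenseRange A := by
  have h : A.range.topologicalClosure = ⊤ := by
    rw [Submodule.topologicalClosure_eq_top_iff, ContinuousLinearMap.orthogonal_range]
    exact LinearMap.ker_eq_bot.2 hA
  exact Submodule.dense_iff_topologicalClosure_eq_top.2 h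

/-- A point that is not an eigenvalue is not charged: the range of `T - c` is dense, and the
mass of `{c}` depends continuously on the vector. -/
theorem spectralMeasure_singleton_eq_zero {T : H →L[ℂ] H} (hT : IsSelfAdjoint T) {c : ℝ}
    (hc : Function.Injective (T - (c : ℂ) • ContinuousLinearMap.id ℂ H)) (x : H) :
    spectralMeasure T x {c} = 0 := by
  have hsa : ContinuousLinearMap.adjoint (T - (c : ℂ) • ContinuousLinearMap.id ℂ H) =
      T - (c : ℂ) • ContinuousLinearMap.id ℂ H := by
    rw [map_sub, hT.adjoint_eq, map_smulₛₗ, ContinuousLinearMap.adjoint_id, Complex.conj_ofReal]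
  have hd := ContinuousLinearMap.denseRange_of_injective_adjoint (hsa.symm ▸ hc)
  have key : ∀ η : ℝ, 0 < η → spectralMeasure T x {c} ≤ ENNReal.ofReal (2 * η ^ 2) := by
    intro η hη
    obtain ⟨z, hz⟩ := hd.exists_dist_lt x hη
    have h0 := spectralMeasure_singleton_of_range hT c z
    have hle := spectralMeasure_sub_le hT (T z - (c : ℂ) • z) (T z - (c : ℂ) • z - x) one_pos {c}
    rw [sub_sub_cancel] at hle
    have hu : spectralMeasure T (T z - (c : ℂ) • z - x) {c} ≤ ENNReal.ofReal (η ^ 2) := by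
      refine (measure_mono (Set.subset_univ _)).trans ?_
      rw [spectralMeasure_univ hT]
      gcongr
      rw [← dist_eq_norm, dist_comm]
      simpa using hz.le
    calc spectralMeasure T x {c}
        ≤ ENNReal.ofReal (1 + 1) * spectralMeasure T (T z - (c : ℂ) • z) {c} +
          ENNReal.ofReal (1 + 1⁻¹) * spectralMeasure T (T z - (c : ℂ) • z - x) {c} := hle
      _ ≤ ENNReal.ofReal (2 * η ^ 2) := by
          rw [h0, mul_zero, zero_add, inv_one, one_add_one_eq_two, ENNReal.ofReal_mul zero_le_two]
          gcongr
  refine le_antisymm (ge_of_tendsto (x := nhdsWithin 0 (Set.Ioi 0)) ?_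
    (eventually_nhdsWithin_of_forall key)) bot_le
  refine tendsto_nhdsWithin_of_tendsto_nhds ?_
  have : Continuous fun η : ℝ => ENNReal.ofReal (2 * η ^ 2) :=
    ENNReal.continuous_ofReal.comp (by fun_prop)
  simpa using this.tendsto 0

/-! ### Recovering `‖u‖` from the spectral measure at `B u` -/

/-- Cauchy–Schwarz for the form of `(T + δ)⁻¹`, `T` positive: in `⟪x, w⟫` insert
`(T + δ)^(-1/2) (T + δ)^(1/2)`. -/
theorem norm_inner_sq_le_lintegral_inv {T : H →L[ℂ] H} (hT : 0 ≤ T)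
    {δ : ℝ} (hδ : 0 < δ) (x w : H) :
    ENNReal.ofReal (‖⟪x, w⟫_ℂ‖ ^ 2) ≤
      (∫⁻ t, ENNReal.ofReal (max t 0 + δ)⁻¹ ∂(spectralMeasure T x)) *
        ENNReal.ofReal ((⟪w, T w⟫_ℂ).re + δ * ‖w‖ ^ 2) := by
  have hsa : IsSelfAdjoint T := hT.isSelfAdjoint
  set q : ℝ → ℝ := fun t => √(max t 0 + δ) with hq
  have hpos : ∀ t : ℝ, 0 < max t 0 + δ := fun t => by positivity
  have hq0 : ∀ t, q t ≠ 0 := fun t => (Real.sqrt_pos.2 (hpos t)).ne'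
  have hqc : Continuous q := by fun_prop
  have hqi : Continuous fun t => (q t)⁻¹ := hqc.inv₀ hq0
  have hone : cfc (fun t => (q t)⁻¹) T * cfc q T = 1 := by
    rw [← cfc_mul _ q T hqi.continuousOn hqc.continuousOn]
    simp only [inv_mul_cancel₀ (hq0 _)]
    exact cfc_const_one ℝ T
  have hs : IsSelfAdjoint (cfc (fun t => (q t)⁻¹) T) := cfc_predicate _ T
  have hin : ⟪x, w⟫_ℂ = ⟪cfc (fun t => (q t)⁻¹) T x, cfc q T w⟫_ℂ := by
    conv_lhs => rw [show w = (cfc (fun t => (q t)⁻¹) T) (cfc q T w) from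
      (DFunLike.congr_fun hone w).symm]
    rw [← ContinuousLinearMap.adjoint_inner_left, hs.adjoint_eq]
  have h1 := lintegral_sq_spectralMeasure T x hqi
  simp only [hq, inv_pow, Real.sq_sqrt (hpos _).le] at h1
  have h2 : ‖cfc q T w‖ ^ 2 = (⟪w, T w⟫_ℂ).re + δ * ‖w‖ ^ 2 := by
    rw [norm_cfc_apply_sq w hqc]
    have : cfc (fun t => q t ^ 2) T = T + (δ : ℂ) • ContinuousLinearMap.id ℂ H := by
      rw [cfc_congr (g := fun t => t + δ) fun t ht => ?_, cfc_add_const δ (fun t => t) T,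
        cfc_id' ℝ T]
      · ext v
        simp [Algebra.algebraMap_eq_smul_one]
      · simp only [hq]
        rw [Real.sq_sqrt (hpos t).le, max_eq_left (spectrum_nonneg_of_nonneg hT ht)]
    rw [this]
    have hw : (⟪w, w⟫_ℂ).re = ‖w‖ ^ 2 := by
      rw [inner_self_eq_norm_sq_to_K]
      norm_cast
    rw [_root_.add_apply, _root_.smul_apply, ContinuousLinearMap.id_apply, inner_add_right,
      inner_smul_right, Complex.add_re, Complex.re_ofReal_mul, hw]
  rw [h1, ← h2, ← ENNReal.ofReal_mul (by positivity), hin, ← mul_pow]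
  gcongr
  exact norm_inner_le_norm _ _

/-- `‖u‖² ≤ ∫ t⁻¹ dμ_{Bu}` for the spectral measure of `BB*`. By injectivity of `B` the vectors
`B* w` are dense, so it is enough to bound `⟪u, B* w⟫ = ⟪B u, w⟫`, which is done by
Cauchy–Schwarz for `(BB* + δ)⁻¹` in the limit `δ → 0`. -/
theorem norm_sq_le_lintegral_inv_spectralMeasure {B : H →L[ℂ] H} (hB : Function.Injective B) {u : H}
    (hpos : ∀ᵐ t ∂(spectralMeasure (B ∘L B.adjoint) (B u)), 0 < t) :
    ENNReal.ofReal (‖u‖ ^ 2) ≤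
      ∫⁻ t, ENNReal.ofReal t⁻¹ ∂(spectralMeasure (B ∘L B.adjoint) (B u)) := by
  set T := B ∘L B.adjoint with hTdef
  have hT : 0 ≤ T := (ContinuousLinearMap.nonneg_iff_isPositive _).2
    (ContinuousLinearMap.isPositive_self_comp_adjoint B)
  by_cases htop : ∫⁻ t, ENNReal.ofReal t⁻¹ ∂(spectralMeasure T (B u)) = ∞
  · rw [htop]
    exact le_top
  set M := (∫⁻ t, ENNReal.ofReal t⁻¹ ∂(spectralMeasure T (B u))).toReal with hM
  have hM0 : 0 ≤ M := ENNReal.toReal_nonneg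
  rw [← ENNReal.ofReal_toReal htop, ← hM]
  refine ENNReal.ofReal_le_ofReal ?_
  have hδ : ∀ w : H, ∀ δ : ℝ, 0 < δ →
      ‖⟪u, B.adjoint w⟫_ℂ‖ ^ 2 ≤ M * (‖B.adjoint w‖ ^ 2 + δ * ‖w‖ ^ 2) := by
    intro w δ hδ
    have hTw : (⟪w, T w⟫_ℂ).re = ‖B.adjoint w‖ ^ 2 := by
      rw [hTdef, ContinuousLinearMap.comp_apply, ← ContinuousLinearMap.adjoint_inner_left,
        inner_self_eq_norm_sq_to_K]
      norm_cast
    have h := norm_inner_sq_le_lintegral_inv hT hδ (B u) w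
    rw [hTw, ← ContinuousLinearMap.adjoint_inner_right] at h
    refine (ENNReal.ofReal_le_ofReal_iff (by positivity)).1 (h.trans ?_)
    rw [ENNReal.ofReal_mul hM0, hM, ENNReal.ofReal_toReal htop]
    refine mul_le_mul' (lintegral_mono_ae ?_) le_rfl
    filter_upwards [hpos] with t ht
    gcongr
    rw [max_eq_left ht.le]
    linarith
  have hw : ∀ w : H, ‖⟪u, B.adjoint w⟫_ℂ‖ ^ 2 ≤ M * ‖B.adjoint w‖ ^ 2 := by
    intro w
    refine ge_of_tendsto (x := nhdsWithin 0 (Set.Ioi 0)) ?_ (eventually_nhdsWithin_of_forall (hδ w))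
    refine tendsto_nhdsWithin_of_tendsto_nhds ?_
    have : Continuous fun δ : ℝ => M * (‖B.adjoint w‖ ^ 2 + δ * ‖w‖ ^ 2) := by fun_prop
    simpa using this.tendsto 0
  have hd : DenseRange B.adjoint := ContinuousLinearMap.denseRange_of_injective_adjoint
    (by rwa [ContinuousLinearMap.adjoint_adjoint])
  have hall : ‖⟪u, u⟫_ℂ‖ ^ 2 ≤ M * ‖u‖ ^ 2 :=
    hd.induction_on (p := fun v => ‖⟪u, v⟫_ℂ‖ ^ 2 ≤ M * ‖v‖ ^ 2) u
      (isClosed_le (by fun_prop) (by fun_prop)) hw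
  rw [inner_self_eq_norm_sq_to_K] at hall
  rcases eq_or_ne u 0 with rfl | hu
  · simpa using hM0
  · have h2 : 0 < ‖u‖ ^ 2 := by positivity
    refine le_of_mul_le_mul_right ?_ h2
    simpa [← sq] using hall

theorem ae_mem_Ioo_spectralMeasure {B : H →L[ℂ] H} {c₀ : ℝ} (hnorm : ‖B‖ ^ 2 ≤ c₀)
    (h0 : Function.Injective (B ∘L B.adjoint))
    (htop : Function.Injective (B ∘L B.adjoint - (c₀ : ℂ) • ContinuousLinearMap.id ℂ H)) (x : H) :
    ∀ᵐ t ∂(spectralMeasure (B ∘L B.adjoint) x), t ∈ Set.Ioo 0 c₀ := by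
  have hT : 0 ≤ B ∘L B.adjoint := (ContinuousLinearMap.nonneg_iff_isPositive _).2
    (ContinuousLinearMap.isPositive_self_comp_adjoint B)
  have hn : ‖B ∘L B.adjoint‖ ≤ c₀ := by
    refine (ContinuousLinearMap.opNorm_comp_le _ _).trans ?_
    rwa [LinearIsometryEquiv.norm_map, ← sq]
  have hsa : IsSelfAdjoint (B ∘L B.adjoint) := hT.isSelfAdjoint
  have hz : spectralMeasure (B ∘L B.adjoint) x {0} = 0 :=
    spectralMeasure_singleton_eq_zero hsa (by simpa using h0) x
  have hc := spectralMeasure_singleton_eq_zero hsa htop x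
  filter_upwards [ae_mem_spectrum_spectralMeasure (B ∘L B.adjoint) x,
    measure_eq_zero_iff_ae_notMem.1 hz, measure_eq_zero_iff_ae_notMem.1 hc] with t ht htz htc
  have ht0 : 0 ≤ t := spectrum_nonneg_of_nonneg hT ht
  have htn : t ≤ c₀ := by
    have : Nontrivial (H →L[ℂ] H) := by
      by_contra hsub
      rw [not_nontrivial_iff_subsingleton] at hsub
      rw [spectrum.of_subsingleton] at ht
      exact ht
    exact ((le_abs_self t).trans (spectrum.norm_le_norm_of_mem ht)).trans hn
  exact ⟨lt_of_le_of_ne ht0 fun h => htz h.symm, lt_of_le_of_ne htn htc⟩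

/-! ### Supporting lines and Jensen's inequality -/

/-- A monotone concave function has a supporting line of non-negative slope at each point of an
upper set that is not its minimum. -/
theorem ConcaveOn.exists_nonneg_supportingLine {J : Set ℝ} (hJ : IsUpperSet J) {Ψ : ℝ → ℝ}
    (hmono : MonotoneOn Ψ J) (hconc : ConcaveOn ℝ J Ψ) {p s₀ : ℝ} (hp : p ∈ J) (hps : p < s₀) :
    ∃ k, 0 ≤ k ∧ ∀ s ∈ J, Ψ s ≤ Ψ s₀ + k * (s - s₀) := by
  have hs₀ : s₀ ∈ J := hJ hps.le hp
  set A : Set ℝ := (fun y => (Ψ y - Ψ s₀) / (y - s₀)) '' Set.Ioi s₀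
  have hub : ∀ s ∈ J, s < s₀ → (Ψ s₀ - Ψ s) / (s₀ - s) ∈ upperBounds A := by
    rintro s hs hlt _ ⟨y, hy, rfl⟩
    exact hconc.slope_anti_adjacent hs (hJ (le_of_lt hy) hs₀) hlt hy
  have hle : ∀ y, s₀ < y → (Ψ y - Ψ s₀) / (y - s₀) ≤ sSup A := fun y hy =>
    le_csSup ⟨_, hub p hp hps⟩ ⟨y, hy, rfl⟩
  refine ⟨sSup A, ?_, fun s hs => ?_⟩
  · have h1 : s₀ < s₀ + 1 := lt_add_one s₀
    refine le_trans (div_nonneg (sub_nonneg.2 ?_) (sub_nonneg.2 h1.le)) (hle _ h1)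
    exact hmono hs₀ (hJ h1.le hs₀) h1.le
  · rcases lt_trichotomy s s₀ with h | rfl | h
    · have := csSup_le (Set.nonempty_Ioi.image _) (hub s hs h)
      rw [le_div_iff₀ (sub_pos.2 h)] at this
      linarith
    · simp
    · have := hle s h
      rw [div_le_iff₀ (sub_pos.2 h)] at this
      linarith

/-- Jensen's inequality for a monotone concave `Ψ`, with an upper bound `s₀` in place of the mean
of `X`. Neither integrability of `Y` nor continuity of `Ψ` at the end point of `J` is assumed: if
`s₀` is the minimum of `J`, then `X = s₀` almost everywhere. -/
theorem lintegral_le_of_le_concave {α : Type*} [MeasurableSpace α] {μ : Measure α}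
    [IsFiniteMeasure μ] [NeZero μ] {J : Set ℝ} (hJ : IsUpperSet J) {Ψ : ℝ → ℝ}
    (hnonneg : ∀ s ∈ J, 0 ≤ Ψ s)
    (hmono : MonotoneOn Ψ J) (hconc : ConcaveOn ℝ J Ψ) {X Y : α → ℝ} (hX : AEMeasurable X μ)
    (hXJ : ∀ᵐ t ∂μ, X t ∈ J) (hX0 : ∀ᵐ t ∂μ, 0 ≤ X t) (hY0 : ∀ᵐ t ∂μ, 0 ≤ Y t)
    (hYX : ∀ᵐ t ∂μ, Y t ≤ Ψ (X t)) {s₀ : ℝ} (hs₀ : 0 ≤ s₀)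
    (hint : ∫⁻ t, ENNReal.ofReal (X t) ∂μ ≤ ENNReal.ofReal s₀ * μ Set.univ) :
    0 ≤ Ψ s₀ ∧ ∫⁻ t, ENNReal.ofReal (Y t) ∂μ ≤ ENNReal.ofReal (Ψ s₀) * μ Set.univ := by
  obtain ⟨hs₀J, k, hk, hline⟩ : s₀ ∈ J ∧ ∃ k, 0 ≤ k ∧ ∀ᵐ t ∂μ, Y t ≤ Ψ s₀ + k * (X t - s₀) := by
    by_cases hmin : ∃ p ∈ J, p < s₀
    · obtain ⟨p, hp, hps⟩ := hmin
      obtain ⟨k, hk, hs⟩ := ConcaveOn.exists_nonneg_supportingLine hJ hmono hconc hp hps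
      refine ⟨hJ hps.le hp, k, hk, ?_⟩
      filter_upwards [hXJ, hYX] with t ht hY using hY.trans (hs _ ht)
    · push Not at hmin
      have hle : (fun _ => ENNReal.ofReal s₀) ≤ᵐ[μ] fun t => ENNReal.ofReal (X t) := by
        filter_upwards [hXJ] with t ht using ENNReal.ofReal_le_ofReal (hmin _ ht)
      have heq := ae_eq_of_ae_le_of_lintegral_le hle (by
        rw [lintegral_const]
        exact ENNReal.mul_ne_top ENNReal.ofReal_ne_top (measure_ne_top _ _))
        hX.ennreal_ofReal (by rwa [lintegral_const])
      have hXs : ∀ᵐ t ∂μ, X t = s₀ := by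
        filter_upwards [heq, hX0] with t ht h0
        exact ((ENNReal.ofReal_eq_ofReal_iff hs₀ h0).1 ht).symm
      obtain ⟨t, ht, htJ⟩ := (hXs.and hXJ).exists
      refine ⟨ht ▸ htJ, 0, le_rfl, ?_⟩
      filter_upwards [hXs, hYX] with t ht hY
      simpa [ht] using hY
  refine ⟨hnonneg _ hs₀J, ?_⟩
  -- The line is integrated with the negative term on the left, to stay inside `ℝ≥0∞`.
  have hks : ENNReal.ofReal (k * s₀) * μ Set.univ ≠ ∞ :=
    ENNReal.mul_ne_top ENNReal.ofReal_ne_top (measure_ne_top _ _)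
  refine (ENNReal.add_le_add_iff_left hks).1 ?_
  calc ENNReal.ofReal (k * s₀) * μ Set.univ + ∫⁻ t, ENNReal.ofReal (Y t) ∂μ
      = ∫⁻ t, (ENNReal.ofReal (k * s₀) + ENNReal.ofReal (Y t)) ∂μ := by
        rw [lintegral_add_left measurable_const, lintegral_const]
    _ ≤ ∫⁻ t, (ENNReal.ofReal (Ψ s₀) + ENNReal.ofReal k * ENNReal.ofReal (X t)) ∂μ := by
        refine lintegral_mono_ae ?_
        filter_upwards [hline, hX0, hY0] with t ht h0 hY
        rw [← ENNReal.ofReal_mul hk, ← ENNReal.ofReal_add (by positivity) hY,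
          ← ENNReal.ofReal_add (hnonneg _ hs₀J) (by positivity)]
        exact ENNReal.ofReal_le_ofReal (by linarith)
    _ = ENNReal.ofReal (Ψ s₀) * μ Set.univ + ENNReal.ofReal k * ∫⁻ t, ENNReal.ofReal (X t) ∂μ := by
        rw [lintegral_add_left measurable_const, lintegral_const,
          lintegral_const_mul' _ _ ENNReal.ofReal_ne_top]
    _ ≤ ENNReal.ofReal (Ψ s₀) * μ Set.univ + ENNReal.ofReal k *
          (ENNReal.ofReal s₀ * μ Set.univ) := by gcongr
    _ = ENNReal.ofReal (k * s₀) * μ Set.univ + ENNReal.ofReal (Ψ s₀) * μ Set.univ := by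
        rw [ENNReal.ofReal_mul hk]
        ring
/-! ### The error bound -/

theorem theorem1
    (B : L2R →L[ℂ] L2R) (hB : Function.Injective B)
    (c₀ : ℝ) (hc₀ : 0 < c₀) (hnorm : ‖B‖ ^ 2 ≤ c₀)
    (hinj_zero : Function.Injective (B ∘L B.adjoint))
    (hinj_top : Function.Injective
      (B ∘L B.adjoint - (c₀ : ℂ) • ContinuousLinearMap.id ℂ L2R))
    (ψ : ℝ → ℝ) (hψ_nonneg : ∀ t, 1 / c₀ < t → 0 ≤ ψ t)
    (hψ_mono : MonotoneOn ψ (Set.Ioi (1 / c₀)))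
    (J : Set ℝ) (hJ : IsUpperSet J) (hψJ : Set.MapsTo ψ (Set.Ioi (1 / c₀)) J)
    (Ψ : ℝ → ℝ) (hΨ_nonneg : ∀ s ∈ J, 0 ≤ Ψ s)
    (hΨ_mono : MonotoneOn Ψ J) (hΨ_concave : ConcaveOn ℝ J Ψ)
    (hΨψ : ∀ t, 1 / c₀ < t → t ≤ Ψ (ψ t))
    (C ε : ℝ) (f g fα : L2R) (hg : g = B f) (hgψ : g ∈ scaleSpace B ψ)
    (hfαψ : B fα ∈ scaleSpace B ψ) (hstable : scaleNorm B ψ (B fα) ≤ C)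
    (hconsistent : ‖B fα - g‖ = ε) :
    ‖f - fα‖ ≤ ε * Real.sqrt (Ψ ((C + scaleNorm B ψ g) ^ 2 / ε ^ 2)) := by
  have hε : 0 ≤ ε := hconsistent ▸ norm_nonneg _
  rcases hε.eq_or_lt with rfl | hε
  · have h := sub_eq_zero.1 (norm_eq_zero.1 hconsistent)
    rw [hg] at h
    simp [hB h]
  set T := B ∘L B.adjoint with hTdef
  have hT : IsSelfAdjoint T := (ContinuousLinearMap.isPositive_self_comp_adjoint B).isSelfAdjoint
  have hBu : B fα - g = B (fα - f) := by rw [hg, map_sub]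
  set μ := spectralMeasure T (B fα - g) with hμ
  have hfin : IsFiniteMeasure μ := isFiniteMeasure_spectralMeasure hT _
  have huniv : μ Set.univ = ENNReal.ofReal (ε ^ 2) := by
    rw [hμ, spectralMeasure_univ hT, hconsistent]
  have hne : NeZero μ := ⟨fun h0 => by
    rw [h0] at huniv
    exact (ENNReal.ofReal_pos.2 (by positivity : 0 < ε ^ 2)).ne huniv⟩
  have hsupp : ∀ᵐ t ∂μ, t ∈ Set.Ioo 0 c₀ := ae_mem_Ioo_spectralMeasure hnorm hinj_zero hinj_top _
  have hinv : ∀ t ∈ Set.Ioo 0 c₀, 1 / c₀ < t⁻¹ := fun t ht => by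
    rw [← one_div]
    exact one_div_lt_one_div_of_lt ht.1 ht.2
  have hψmeas : AEMeasurable (fun t => ψ t⁻¹) μ := by
    rw [← Measure.restrict_eq_self_of_ae_mem hsupp]
    refine aemeasurable_restrict_of_antitoneOn measurableSet_Ioo fun s hs t ht hst => ?_
    exact hψ_mono (hinv t ht) (hinv s hs) (inv_anti₀ hs.1 hst)
  have hform : ∫⁻ t, ENNReal.ofReal (ψ t⁻¹) ∂μ ≤
      ENNReal.ofReal ((C + scaleNorm B ψ g) ^ 2 / ε ^ 2) * μ Set.univ := by
    rw [huniv, ← ENNReal.ofReal_mul (by positivity), div_mul_cancel₀ _ (by positivity)]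
    refine (sqrt_lintegral_spectralMeasure_sub_le hT _ (ne_of_lt hfαψ) (ne_of_lt hgψ)).trans ?_
    refine ENNReal.ofReal_le_ofReal ?_
    exact pow_le_pow_left₀ (by positivity) (by gcongr; exacts [hstable, le_rfl]) 2
  obtain ⟨hΨ0, hle⟩ := lintegral_le_of_le_concave (μ := μ) hJ hΨ_nonneg hΨ_mono hΨ_concave hψmeas
    (hsupp.mono fun t ht => hψJ (hinv t ht)) (hsupp.mono fun t ht => hψ_nonneg _ (hinv t ht))
    (hsupp.mono fun t ht => (inv_pos.2 ht.1).le) (hsupp.mono fun t ht => hΨψ _ (hinv t ht))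
    (by positivity) hform
  have hlow : ENNReal.ofReal (‖fα - f‖ ^ 2) ≤ ∫⁻ t, ENNReal.ofReal t⁻¹ ∂μ := by
    rw [hμ, hBu]
    refine norm_sq_le_lintegral_inv_spectralMeasure hB ?_
    rw [← hBu]
    exact hsupp.mono fun t ht => ht.1
  have hfinal := hlow.trans hle
  rw [huniv, ← ENNReal.ofReal_mul hΨ0, ENNReal.ofReal_le_ofReal_iff (by positivity)] at hfinal
  rw [norm_sub_rev]
  refine le_of_sq_le_sq ?_ (by positivity)
  rw [mul_pow, Real.sq_sqrt hΨ0]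
  linarith
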